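/- Let $\kappa>0$ and let $X$ be a complete CAT$(\kappa)$ space with $\operatorname{diam}(X)<\pi/(2\sqrt{\kappa})$. Let $r\ge 1$ and let $C_1,\dots,C_r\subseteq X$ be closed convex sets with $\bigcap_{i=1}^r C_i\neq\emptyset$, at least one of which is locally compact. (A set is convex if it contains every geodesic segment joining two of its points.) Let $P_{C_i}$ denote the metric projection onto $C_i$, which maps each $x\in X$ to its nearest point in $C_i$. Let $(\varepsilon_n)_{n\ge 0}$ be real numbers with $\sum_{n=0}^\infty\varepsilon_n<\infty$, and let $(x_n)_{n\ge 0}$ be any sequence in $X$, with arbitrary starting point $x_0\in X$, such that $$d\bigl(x_{n+1},\,P_{C_{\overline{n}}}(x_n)\bigr)\le\varepsilon_n\quad\text{for every } n\ge 0,\qquad \overline{n}:=(n \bmod r)+1 .$$ (In particular, all $\varepsilon_n$ are nonnegative.) Then $(x_n)$ converges in the metric of $X$ to some point of $\bigcap_{i=1}^r C_i$. -/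

import Mathlib

open Set Filter Topology

noncomputable section

/-- `γ : [0, l] → X` is a geodesic path that joins `x` and `y`
(only the values of `γ` on `[0, l]` matter). -/
structure IsGeodesicPath {X : Type*} [MetricSpace X] (γ : ℝ → X) (l : ℝ) (x y : X) : Prop where
  nonneg : 0 ≤ l
  source : γ 0 = x
  target : γ l = y
  isometry : ∀ t ∈ Icc 0 l, ∀ t' ∈ Icc 0 l, dist (γ t) (γ t') = |t - t'|

/-- `S` is a geodesic segment from `x` to `y`: the image of a geodesic path. -/
def IsGeodesicSegment {X : Type*} [MetricSpace X] (S : Set X) (x y : X) : Prop :=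
  ∃ (γ : ℝ → X) (l : ℝ), IsGeodesicPath γ l x y ∧ S = γ '' Icc 0 l

/-- A set is convex if it contains all geodesic segments that join any two of its points. -/
def GeodesicallyConvex {X : Type*} [MetricSpace X] (C : Set X) : Prop :=
  ∀ x ∈ C, ∀ y ∈ C, ∀ S : Set X, IsGeodesicSegment S x y → S ⊆ C

/-- The points of the unit sphere `𝕊²` in Euclidean three-space. -/
abbrev UnitSphere2 : Type := Metric.sphere (0 : EuclideanSpace ℝ (Fin 3)) 1

/-- For `κ > 0`, the distance of the model plane of constant curvature `κ`: the angular distance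
of the unit sphere, multiplied by `1 / √κ`. -/
def modelDist (κ : ℝ) (u v : UnitSphere2) : ℝ :=
  InnerProductGeometry.angle (u : EuclideanSpace ℝ (Fin 3)) (v : EuclideanSpace ℝ (Fin 3)) / √κ

/-- `p', q', r'` are the vertices of a comparison triangle for `p, q, r` in the model plane. -/
structure IsComparisonTriangle {X : Type*} [MetricSpace X] (κ : ℝ) (p q r : X)
    (p' q' r' : UnitSphere2) : Prop where
  dist_pq : modelDist κ p' q' = dist p q
  dist_qr : modelDist κ q' r' = dist q r
  dist_rp : modelDist κ r' p' = dist r p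

/-- `x'` is a comparison point, on the side `[p', q']` of the model triangle, for the point `x` of
a geodesic segment from `p` to `q`. As `dist p x + dist x q = dist p q`, the two equations say that
`x'` is the point of the segment `[p', q']` at distance `dist p x` from `p'`. -/
structure IsComparisonPoint {X : Type*} [MetricSpace X] (κ : ℝ) (p q x : X)
    (p' q' x' : UnitSphere2) : Prop where
  dist_left : modelDist κ p' x' = dist p x
  dist_right : modelDist κ x' q' = dist x q

/-- For `κ > 0`: `X` is a CAT(κ) space. Points at distance less than `π / √κ` are joined by
geodesics, and geodesic triangles of perimeter less than `2π / √κ` are no thicker than their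
comparison triangles in the model plane. Since `p, q, r` are arbitrary, taking one point on a side
`[p, q]` and one on a side `[p, r]` covers every pair of points on two different sides; for two
points on the same side the comparison inequality always holds, with equality. -/
structure IsCAT (κ : ℝ) (X : Type*) [MetricSpace X] : Prop where
  exists_geodesic : ∀ x y : X, dist x y < Real.pi / √κ → ∃ S : Set X, IsGeodesicSegment S x y
  comparison : ∀ (p q r : X) (Spq Spr : Set X),
    dist p q + dist q r + dist r p < 2 * (Real.pi / √κ) →
    IsGeodesicSegment Spq p q → IsGeodesicSegment Spr p r →
    ∀ p' q' r' : UnitSphere2, IsComparisonTriangle κ p q r p' q' r' →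
    ∀ x ∈ Spq, ∀ y ∈ Spr, ∀ x' y' : UnitSphere2,
      IsComparisonPoint κ p q x p' q' x' → IsComparisonPoint κ p r y p' r' y' →
      dist x y ≤ modelDist κ x' y'

/-- The set of points of `C` nearest to `x`. -/
def nearestPoints {X : Type*} [MetricSpace X] (C : Set X) (x : X) : Set X :=
  {c | c ∈ C ∧ dist x c = Metric.infDist x C}

open Classical in
/-- The metric projection onto `C`: the nearest point of `C` to `x` (which exists and is unique for
the sets considered here; the value `x` is used where there is no nearest point). -/
def metricProj {X : Type*} [MetricSpace X] (C : Set X) (x : X) : X :=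
  if h : (nearestPoints C x).Nonempty then h.some else x

/-- `(xₙ)` is generated by the cyclic method with mappings `T₀, …, Tᵣ₋₁` and errors `(εₙ)`, where
`∑ εₙ < ∞`: the mapping applied (inexactly) to `xₙ` has index `n mod r`. -/
structure IsInexactCyclicSeq {X : Type*} [MetricSpace X] {r : ℕ} (hr : 0 < r)
    (T : Fin r → X → X) (ε : ℕ → ℝ) (x : ℕ → X) : Prop where
  summable : Summable ε
  step : ∀ n : ℕ, dist (x (n + 1)) (T ⟨n % r, Nat.mod_lt n hr⟩ (x n)) ≤ ε n

end

/-! The argument combines quasi-Fejér monotonicity with compactness. Rescaled by `√κ`, all distances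
lie below `π / 2`, where cosines are positive and decreasing. CAT comparison then yields the
spherical Pythagorean inequality `IsCAT.cos_dist_le_of_mem_nearestPoints` for the projection `c` of
`x` and any `p` in the set. Hence projecting never increases the distance to a common point `p`. As
the errors are summable, `dist (x n) p` converges.

Put back into the Pythagorean inequality, this convergence forces the cosine of the rescaled
projection step to tend to `1`. So the steps vanish, and since every set is visited within `r`
steps, the distance from `x n` to each set tends to `0`.

The locally compact set is proper by Hopf–Rinow, so points of it that shadow `x n` have a convergent
subsequence. Its limit `u` lies in every set, and `dist (x n) u` converges and tends to `0` along a
subsequence, hence altogether. -/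

/-! ### Hopf–Rinow and real sequences -/

/-- The Hopf–Rinow theorem for complete locally compact spaces in which every pair of points
has points in between at all distances. -/
theorem properSpace_of_exists_between {Y : Type*} [MetricSpace Y] [CompleteSpace Y]
    [LocallyCompactSpace Y]
    (h : ∀ x y : Y, ∀ t ∈ Icc 0 (dist x y), ∃ z, dist x z = t ∧ dist z y = dist x y - t) :
    ProperSpace Y := by
  refine ⟨fun a R => ?_⟩
  have approx : ∀ ρ : ℝ, 0 ≤ ρ → ∀ z, ∃ y ∈ Metric.closedBall a ρ,
      dist z y ≤ max 0 (dist a z - ρ) := by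
    intro ρ hρ z
    rcases le_total (dist a z) ρ with hz | hz
    · exact ⟨z, by simpa [dist_comm] using hz, by simp⟩
    · obtain ⟨y, hy1, hy2⟩ := h a z ρ ⟨hρ, hz⟩
      refine ⟨y, by simp [dist_comm y a, hy1], ?_⟩
      rw [dist_comm, hy2]
      exact le_max_right _ _
  by_contra hR
  -- If some ball about `a` is not compact, the compact radii have a supremum `s`. The ball of
  -- radius `s` turns out compact, and so does a slightly larger one, a contradiction.
  set S : Set ℝ := {ρ | 0 ≤ ρ ∧ IsCompact (Metric.closedBall a ρ)} with hS
  have hmono : ∀ ρ ρ' : ℝ, ρ ≤ ρ' → IsCompact (Metric.closedBall a ρ') →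
      IsCompact (Metric.closedBall a ρ) := fun ρ ρ' hle hc =>
    hc.of_isClosed_subset Metric.isClosed_closedBall (Metric.closedBall_subset_closedBall hle)
  have h0 : (0 : ℝ) ∈ S := ⟨le_rfl, by simp⟩
  have hbdd : BddAbove S := by
    refine ⟨R, fun ρ hρ => ?_⟩
    by_contra hlt
    exact hR (hmono _ _ (not_le.mp hlt).le hρ.2)
  set s := sSup S with hs
  have hs0 : 0 ≤ s := le_csSup hbdd h0
  have hbelow : ∀ ρ : ℝ, ρ < s → IsCompact (Metric.closedBall a ρ) := by
    intro ρ hρ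
    obtain ⟨ρ', hρ', hlt⟩ := exists_lt_of_lt_csSup ⟨0, h0⟩ hρ
    exact hmono _ _ hlt.le hρ'.2
  have hsc : IsCompact (Metric.closedBall a s) := by
    rcases hs0.eq_or_lt with hz | hpos
    · rw [← hz]; exact h0.2
    refine isCompact_iff_totallyBounded_isComplete.mpr
      ⟨Metric.totallyBounded_iff.mpr fun e he => ?_, Metric.isClosed_closedBall.isComplete⟩
    -- Points of the `s`-ball lie within `e / 3` of this smaller compact ball, so an `e / 3`-net of
    -- the latter is an `e`-net.
    have hlt : max 0 (s - e / 3) < s := max_lt hpos (by linarith)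
    obtain ⟨t, ht, hcov⟩ := Metric.totallyBounded_iff.mp (hbelow _ hlt).totallyBounded (e / 3)
      (by positivity)
    refine ⟨t, ht, fun z hz => ?_⟩
    obtain ⟨y, hy, hyz⟩ := approx _ (le_max_left 0 (s - e / 3)) z
    obtain ⟨w, hw, hyw⟩ := mem_iUnion₂.mp (hcov hy)
    refine mem_iUnion₂.mpr ⟨w, hw, ?_⟩
    rw [Metric.mem_ball] at hyw ⊢
    rw [Metric.mem_closedBall, dist_comm] at hz
    have h1 : max 0 (dist a z - max 0 (s - e / 3)) ≤ e / 3 := by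
      refine max_le (by positivity) ?_
      linarith [le_max_right 0 (s - e / 3)]
    linarith [dist_triangle z y w]
  obtain ⟨K, hK, hsub⟩ := exists_compact_superset hsc
  obtain ⟨δ, hδ, hδK⟩ := hsc.exists_cthickening_subset_open isOpen_interior hsub
  have hmem : s + δ ∈ S := by
    refine ⟨by linarith, hK.of_isClosed_subset Metric.isClosed_closedBall fun z hz => ?_⟩
    refine interior_subset (hδK ?_)
    obtain ⟨y, hy, hyz⟩ := approx s hs0 z
    rw [Metric.mem_closedBall, dist_comm] at hz
    exact Metric.mem_cthickening_of_dist_le z y δ _ hy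
      (hyz.trans (max_le hδ.le (by linarith)))
  linarith [le_csSup hbdd hmem]

/-- A nonnegative sequence whose increments are bounded above by a summable sequence converges. -/
theorem exists_tendsto_of_le_add_summable {a ε : ℕ → ℝ} (ha : ∀ n, 0 ≤ a n)
    (hε0 : ∀ n, 0 ≤ ε n) (hε : Summable ε) (h : ∀ n, a (n + 1) ≤ a n + ε n) :
    ∃ L, Tendsto a atTop (𝓝 L) := by
  -- Subtracting the partial sums of the errors leaves a decreasing sequence.
  have hanti : Antitone fun n => a n - ∑ k ∈ Finset.range n, ε k := by
    refine antitone_nat_of_succ_le fun n => ?_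
    rw [Finset.sum_range_succ]
    linarith [h n]
  have hbdd : BddBelow (range fun n => a n - ∑ k ∈ Finset.range n, ε k) := by
    refine ⟨-∑' k, ε k, ?_⟩
    rintro _ ⟨n, rfl⟩
    have := hε.sum_le_tsum (Finset.range n) fun k _ => hε0 k
    simp only
    linarith [ha n]
  refine ⟨_, ((tendsto_atTop_ciInf hanti hbdd).add hε.hasSum.tendsto_sum_nat).congr fun n => ?_⟩
  ring

theorem tendsto_zero_of_tendsto_cos_one {y : ℕ → ℝ} (h0 : ∀ n, 0 ≤ y n) (hpi : ∀ n, y n ≤ Real.pi)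
    (h : Tendsto (fun n => Real.cos (y n)) atTop (𝓝 1)) : Tendsto y atTop (𝓝 0) := by
  have := (Real.continuous_arccos.tendsto 1).comp h
  rw [Real.arccos_one] at this
  exact this.congr fun n => Real.arccos_cos (h0 n) (hpi n)

/-! ### Triangles and segments on the unit sphere -/

section Sphere

open Real InnerProductGeometry

theorem UnitSphere2.angle_eq_arccos (u v : UnitSphere2) :
    angle (u : EuclideanSpace ℝ (Fin 3)) v
      = arccos (inner ℝ (u : EuclideanSpace ℝ (Fin 3)) v) := by
  simp [angle]

theorem UnitSphere2.cos_angle (u v : UnitSphere2) :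
    cos (angle (u : EuclideanSpace ℝ (Fin 3)) v)
      = inner ℝ (u : EuclideanSpace ℝ (Fin 3)) v := by
  rw [InnerProductGeometry.cos_angle]; simp

theorem cos_sqrt_mul_modelDist {κ : ℝ} (hκ : 0 < κ) (u v : UnitSphere2) :
    cos (√κ * modelDist κ u v) = inner ℝ (u : EuclideanSpace ℝ (Fin 3)) v := by
  have : √κ ≠ 0 := (sqrt_pos.mpr hκ).ne'
  rw [modelDist, mul_div_cancel₀ _ this, UnitSphere2.cos_angle]

theorem modelDist_eq_of_inner_eq_cos {κ : ℝ} (hκ : 0 < κ) {u v : UnitSphere2} {d : ℝ}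
    (hd : 0 ≤ d) (hd' : √κ * d ≤ π)
    (h : inner ℝ (u : EuclideanSpace ℝ (Fin 3)) v = cos (√κ * d)) : modelDist κ u v = d := by
  have : √κ ≠ 0 := (sqrt_pos.mpr hκ).ne'
  rw [modelDist, UnitSphere2.angle_eq_arccos, h, arccos_cos (by positivity) hd',
    mul_div_cancel_left₀ _ this]

/-- Existence of spherical triangles with prescribed side lengths. -/
theorem exists_spherical_triangle {a b e : ℝ} (ha : 0 < a) (haπ : a < π)
    (he : 0 ≤ e) (heπ : e ≤ π) (habπ : a + b ≤ π) (h1 : e ≤ a + b) (h2 : a ≤ b + e)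
    (h3 : b ≤ a + e) :
    ∃ p q r : UnitSphere2,
      inner ℝ (p : EuclideanSpace ℝ (Fin 3)) q = cos a ∧
      inner ℝ (p : EuclideanSpace ℝ (Fin 3)) r = cos b ∧
      inner ℝ (q : EuclideanSpace ℝ (Fin 3)) r = cos e := by
  have hs : 0 < sin a := sin_pos_of_pos_of_lt_pi ha haπ
  -- With `p` and `q` in a coordinate plane, `w` is the second coordinate of `r` dictated by the
  -- spherical law of cosines. The triangle inequalities say exactly that it leaves room for a third
  -- coordinate.
  set w := (cos e - cos a * cos b) / sin a with hw
  have hsw : sin a * w = cos e - cos a * cos b := by rw [hw]; field_simp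
  have hl : cos (a + b) ≤ cos e := cos_le_cos_of_nonneg_of_le_pi he habπ h1
  have hu : cos e ≤ cos (a - b) := by
    rw [← cos_abs (a - b)]
    exact cos_le_cos_of_nonneg_of_le_pi (abs_nonneg _) heπ (abs_le.mpr ⟨by linarith, by linarith⟩)
  rw [cos_add] at hl
  rw [cos_sub] at hu
  have hwb : w ^ 2 ≤ sin b ^ 2 := by
    refine sq_le_sq' ?_ ?_
    · refine le_of_mul_le_mul_left ?_ hs
      linarith
    · refine le_of_mul_le_mul_left ?_ hs
      linarith
  have hsq : √(sin b ^ 2 - w ^ 2) ^ 2 = sin b ^ 2 - w ^ 2 := sq_sqrt (by linarith)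
  refine ⟨⟨!₂[1, 0, 0], ?_⟩, ⟨!₂[cos a, sin a, 0], ?_⟩,
    ⟨!₂[cos b, w, √(sin b ^ 2 - w ^ 2)], ?_⟩, ?_, ?_, ?_⟩
  · simp [EuclideanSpace.norm_eq, Fin.sum_univ_three]
  · simp [EuclideanSpace.norm_eq, Fin.sum_univ_three]
  · simp only [mem_sphere_iff_norm, sub_zero, EuclideanSpace.norm_eq, Fin.sum_univ_three,
      norm_eq_abs, sq_abs, sqrt_eq_one]
    simp [hsq]
  · simp [PiLp.inner_apply, Fin.sum_univ_three]
  · simp [PiLp.inner_apply, Fin.sum_univ_three]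
  · simp [PiLp.inner_apply, Fin.sum_univ_three]
    linarith

/-- The point at distance `t` on a spherical segment of length `l`. -/
theorem exists_spherical_segment_point {l t : ℝ} (hl : 0 < l) (hlπ : l < π)
    (p q : UnitSphere2) (h : inner ℝ (p : EuclideanSpace ℝ (Fin 3)) q = cos l) :
    ∃ z : UnitSphere2, inner ℝ (p : EuclideanSpace ℝ (Fin 3)) z = cos t ∧
      inner ℝ (z : EuclideanSpace ℝ (Fin 3)) q = cos (l - t) ∧
      ∀ r : UnitSphere2, sin l * inner ℝ (z : EuclideanSpace ℝ (Fin 3)) r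
        = sin (l - t) * inner ℝ (p : EuclideanSpace ℝ (Fin 3)) r
          + sin t * inner ℝ (q : EuclideanSpace ℝ (Fin 3)) r := by
  have hs : 0 < sin l := sin_pos_of_pos_of_lt_pi hl hlπ
  set z : EuclideanSpace ℝ (Fin 3) :=
    (sin l)⁻¹ • (sin (l - t) • (p : EuclideanSpace ℝ (Fin 3)) + sin t • q) with hz
  have key : ∀ r : EuclideanSpace ℝ (Fin 3), sin l * inner ℝ z r
      = sin (l - t) * inner ℝ (p : EuclideanSpace ℝ (Fin 3)) r
          + sin t * inner ℝ (q : EuclideanSpace ℝ (Fin 3)) r := by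
    intro r
    rw [hz, real_inner_smul_left, inner_add_left, real_inner_smul_left, real_inner_smul_left,
      mul_inv_cancel_left₀ hs.ne']
  have hpp : inner ℝ (p : EuclideanSpace ℝ (Fin 3)) p = 1 := by
    rw [real_inner_self_eq_norm_sq]; simp
  have hqq : inner ℝ (q : EuclideanSpace ℝ (Fin 3)) q = 1 := by
    rw [real_inner_self_eq_norm_sq]; simp
  have hsc := sin_sq_add_cos_sq l
  have hp : inner ℝ z (p : EuclideanSpace ℝ (Fin 3)) = cos t := by
    refine mul_left_cancel₀ hs.ne' ?_
    rw [key, hpp, real_inner_comm, h, sin_sub]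
    ring
  have hq : inner ℝ z (q : EuclideanSpace ℝ (Fin 3)) = cos (l - t) := by
    refine mul_left_cancel₀ hs.ne' ?_
    rw [key, hqq, h, sin_sub, cos_sub]
    linear_combination (sin t) * (-hsc)
  have hzz : inner ℝ z z = 1 := by
    refine mul_left_cancel₀ hs.ne' ?_
    rw [key, real_inner_comm, hp, real_inner_comm, hq, mul_comm (sin t), ← sin_add]
    simp
  have hnorm : ‖z‖ = 1 := by
    rw [real_inner_self_eq_norm_sq] at hzz
    exact (pow_eq_one_iff_of_nonneg (norm_nonneg z) two_ne_zero).mp hzz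
  exact ⟨⟨z, by simp [hnorm]⟩, by rw [real_inner_comm]; exact hp, hq, fun r => key r⟩

end Sphere

/-! ### Comparison and projections in CAT(κ) spaces -/

section CAT

open Real

variable {X : Type*} [MetricSpace X]

theorem IsGeodesicPath.length_eq {γ : ℝ → X} {l : ℝ} {x y : X} (h : IsGeodesicPath γ l x y) :
    l = dist x y := by
  have := h.isometry 0 (left_mem_Icc.mpr h.nonneg) l (right_mem_Icc.mpr h.nonneg)
  rw [h.source, h.target, zero_sub, abs_neg, abs_of_nonneg h.nonneg] at this
  exact this.symm

theorem IsGeodesicPath.dist_left {γ : ℝ → X} {l : ℝ} {x y : X} (h : IsGeodesicPath γ l x y)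
    {t : ℝ} (ht : t ∈ Icc 0 l) : dist x (γ t) = t := by
  have := h.isometry 0 (left_mem_Icc.mpr h.nonneg) t ht
  rwa [h.source, zero_sub, abs_neg, abs_of_nonneg ht.1] at this

theorem IsGeodesicPath.dist_right {γ : ℝ → X} {l : ℝ} {x y : X} (h : IsGeodesicPath γ l x y)
    {t : ℝ} (ht : t ∈ Icc 0 l) : dist (γ t) y = l - t := by
  have := h.isometry t ht l (right_mem_Icc.mpr h.nonneg)
  rwa [h.target, abs_sub_comm, abs_of_nonneg (sub_nonneg.mpr ht.2)] at this

theorem IsGeodesicPath.mem_of_convex {γ : ℝ → X} {l : ℝ} {x y : X} (h : IsGeodesicPath γ l x y)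
    {C : Set X} (hC : GeodesicallyConvex C) (hx : x ∈ C) (hy : y ∈ C) {t : ℝ}
    (ht : t ∈ Icc 0 l) : γ t ∈ C :=
  hC x hx y hy _ ⟨γ, l, h, rfl⟩ (mem_image_of_mem γ ht)

/-- In a `CAT(κ)` space of diameter less than `π / (2√κ)`, the function `cos (√κ d(x, ·))`
is bounded below along geodesics by its spherical counterpart. -/
theorem IsCAT.sin_mul_cos_dist_ge {κ : ℝ} (hκ : 0 < κ) (hX : IsCAT κ X)
    (hd : ∀ x y : X, √κ * dist x y < π / 2) {γ : ℝ → X} {l : ℝ} {c p : X}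
    (hγ : IsGeodesicPath γ l c p) (x : X) {t : ℝ} (ht : t ∈ Icc 0 l) :
    sin (√κ * (l - t)) * cos (√κ * dist x c) + sin (√κ * t) * cos (√κ * dist x p)
      ≤ sin (√κ * l) * cos (√κ * dist x (γ t)) := by
  have hk : 0 < √κ := sqrt_pos.mpr hκ
  have hlen := hγ.length_eq
  rcases hγ.nonneg.eq_or_lt with h0 | hl
  · have ht0 : t = 0 := le_antisymm (h0 ▸ ht.2) ht.1
    simp [← h0, ht0]
  have hpi := pi_pos
  have hmul : ∀ u v w : X, √κ * dist u w ≤ √κ * dist u v + √κ * dist v w := fun u v w => by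
    rw [← mul_add]; exact mul_le_mul_of_nonneg_left (dist_triangle u v w) hk.le
  have hd0 : ∀ u v : X, 0 ≤ √κ * dist u v := fun u v => by positivity
  have hkl : 0 < √κ * dist c p := by rw [← hlen]; positivity
  -- The second side of the triangle is `[c, x]`, with its endpoint `x` as the chosen point, so the
  -- comparison bounds the distance from a vertex to the opposite side.
  obtain ⟨c', p', x', h1, h2, h3⟩ := exists_spherical_triangle
    (a := √κ * dist c p) (b := √κ * dist c x) (e := √κ * dist p x) hkl
    (by linarith [hd c p]) (hd0 _ _) (by linarith [hd p x])
    (by linarith [hd c p, hd c x])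
    (by rw [dist_comm c p]; exact hmul p c x)
    (by rw [dist_comm p x]; exact hmul c x p)
    (hmul c p x)
  obtain ⟨z', hz1, hz2, hz3⟩ := exists_spherical_segment_point (t := √κ * t) hkl
    (by linarith [hd c p]) c' p' h1
  have hdlt : ∀ u v : X, dist u v < π / √κ / 2 := fun u v => by
    rw [div_right_comm, lt_div_iff₀ hk, mul_comm]; exact hd u v
  have hpk : 0 < π / √κ := by positivity
  obtain ⟨S, hS⟩ := hX.exists_geodesic c x (by linarith [hdlt c x])
  have hle : ∀ u v : X, √κ * dist u v ≤ π := fun u v => by linarith [hd u v]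
  have hxS : x ∈ S := by
    obtain ⟨γ', l', hγ', rfl⟩ := hS
    exact ⟨l', right_mem_Icc.mpr hγ'.nonneg, hγ'.target⟩
  have hcmp := hX.comparison c p x _ S
    (by linarith [hdlt c p, hdlt p x, hdlt x c]) ⟨γ, l, hγ, rfl⟩ hS c' p' x'
    ⟨modelDist_eq_of_inner_eq_cos hκ dist_nonneg (hle _ _) h1,
     modelDist_eq_of_inner_eq_cos hκ dist_nonneg (hle _ _) h3,
     modelDist_eq_of_inner_eq_cos hκ dist_nonneg (hle _ _)
      (by rw [real_inner_comm, h2, dist_comm])⟩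
    (γ t) (mem_image_of_mem γ ht) x hxS z' x'
    ⟨modelDist_eq_of_inner_eq_cos hκ dist_nonneg (hle _ _) (by rw [hz1, hγ.dist_left ht]),
     modelDist_eq_of_inner_eq_cos hκ dist_nonneg (hle _ _)
      (by rw [hz2, hγ.dist_right ht, mul_sub, hlen])⟩
    ⟨modelDist_eq_of_inner_eq_cos hκ dist_nonneg (hle _ _) h2,
     modelDist_eq_of_inner_eq_cos hκ dist_nonneg (hle _ _)
      (by rw [real_inner_self_eq_norm_sq]; simp)⟩
  have hcos : cos (√κ * modelDist κ z' x') ≤ cos (√κ * dist x (γ t)) := by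
    refine cos_le_cos_of_nonneg_of_le_pi (hd0 _ _) ?_ ?_
    · rw [modelDist, mul_div_cancel₀ _ hk.ne']
      exact InnerProductGeometry.angle_le_pi _ _
    · rw [dist_comm x]
      exact mul_le_mul_of_nonneg_left hcmp hk.le
  rw [cos_sqrt_mul_modelDist hκ] at hcos
  have hsin : 0 ≤ sin (√κ * l) := by
    rw [hlen]; exact sin_nonneg_of_nonneg_of_le_pi (hd0 _ _) (hle _ _)
  have := mul_le_mul_of_nonneg_left hcos hsin
  have e := hz3 x'
  rw [h2, h3, ← hlen] at e
  rw [mul_sub, dist_comm x c, dist_comm x p, ← e]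
  exact this

/-- The spherical Pythagorean inequality for nearest points of convex sets. -/
theorem IsCAT.cos_dist_le_of_mem_nearestPoints {κ : ℝ} (hκ : 0 < κ) (hX : IsCAT κ X)
    (hd : ∀ x y : X, √κ * dist x y < π / 2) {C : Set X} (hC : GeodesicallyConvex C) {x c p : X}
    (hc : c ∈ nearestPoints C x) (hp : p ∈ C) :
    cos (√κ * dist x p) ≤ cos (√κ * dist x c) * cos (√κ * dist c p) := by
  have hk : 0 < √κ := sqrt_pos.mpr hκ
  have hpi := pi_pos
  rcases eq_or_ne c p with rfl | hcp
  · simp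
  have hlt : dist c p < π / √κ := by
    rw [lt_div_iff₀ hk, mul_comm]; linarith [hd c p]
  obtain ⟨_, γ, l, hγ, rfl⟩ := hX.exists_geodesic c p hlt
  have hlen := hγ.length_eq
  have hl : 0 < l := hlen ▸ dist_pos.mpr hcp
  have hkl : √κ * l < π / 2 := hlen ▸ hd c p
  -- First variation at `c`: a point of the segment `[c, p]` is no nearer to `x` than `c` is.
  -- Dividing by `2 * sin (√κ * t / 2)` gives a bound that survives `t → 0`.
  have key : ∀ t ∈ Ioo 0 l, cos (√κ * dist x p) * cos (√κ * t / 2)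
      ≤ cos (√κ * dist x c) * cos (√κ * l - √κ * t / 2) := by
    intro t ht
    have ht' : t ∈ Icc 0 l := Ioo_subset_Icc_self ht
    have h1 := hX.sin_mul_cos_dist_ge hκ hd hγ x ht'
    have h2 : cos (√κ * dist x (γ t)) ≤ cos (√κ * dist x c) := by
      refine cos_le_cos_of_nonneg_of_le_pi (by positivity) (by linarith [hd x (γ t)]) ?_
      refine mul_le_mul_of_nonneg_left ?_ hk.le
      rw [hc.2]
      exact Metric.infDist_le_dist_of_mem (hγ.mem_of_convex hC hc.1 hp ht')
    have h3 : 0 ≤ sin (√κ * l) := sin_nonneg_of_nonneg_of_le_pi (by positivity) (by linarith)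
    have hkt : 0 < √κ * t := mul_pos hk ht.1
    have hktl : √κ * t < √κ * l := mul_lt_mul_of_pos_left ht.2 hk
    have h4 : 0 < sin (√κ * t / 2) := sin_pos_of_pos_of_lt_pi (by positivity) (by linarith)
    have h5 := h1.trans (mul_le_mul_of_nonneg_left h2 h3)
    set θ := √κ * t / 2 with hθ
    set A := √κ * l - θ with hA
    have e1 : √κ * (l - t) = A - θ := by rw [hA, hθ]; ring
    have e2 : √κ * t = 2 * θ := by rw [hθ]; ring
    have e3 : √κ * l = A + θ := by rw [hA]; ring
    rw [e1, e2, e3, sin_two_mul, sin_sub, sin_add] at h5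
    refine le_of_mul_le_mul_left ?_ (mul_pos two_pos h4)
    linarith
  have hf : Continuous fun t : ℝ => cos (√κ * dist x p) * cos (√κ * t / 2) := by fun_prop
  have hg : Continuous fun t : ℝ => cos (√κ * dist x c) * cos (√κ * l - √κ * t / 2) := by fun_prop
  have := le_of_tendsto_of_tendsto (hf.continuousWithinAt (s := Ioi 0) (x := 0))
    (hg.continuousWithinAt (s := Ioi 0) (x := 0))
    (by filter_upwards [Ioo_mem_nhdsGT hl] with t ht using key t ht)
  simpa [hlen] using this

/-- Closed convex subsets of complete `CAT(κ)` spaces of small diameter are proximinal. -/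
theorem IsCAT.nearestPoints_nonempty [CompleteSpace X] {κ : ℝ} (hκ : 0 < κ) (hX : IsCAT κ X)
    (hd : ∀ x y : X, √κ * dist x y < π / 2) {C : Set X} (hC : GeodesicallyConvex C)
    (hcl : IsClosed C) (hne : C.Nonempty) (x : X) : (nearestPoints C x).Nonempty := by
  have hk : 0 < √κ := sqrt_pos.mpr hκ
  have hpi := pi_pos
  set D := Metric.infDist x C with hD
  have hD0 : 0 ≤ D := Metric.infDist_nonneg
  have hDpi : √κ * D < π / 2 := by
    obtain ⟨p, hp⟩ := hne
    exact (mul_le_mul_of_nonneg_left (Metric.infDist_le_dist_of_mem hp) hk.le).trans_lt (hd x p)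
  have hcosD : 0 < cos (√κ * D) := cos_pos_of_mem_Ioo ⟨by linarith [mul_nonneg hk.le hD0], hDpi⟩
  have hex : ∀ n : ℕ, ∃ c ∈ C, dist x c < D + 1 / ((n : ℝ) + 1) := fun n =>
    (Metric.infDist_lt_iff hne).mp (lt_add_of_pos_right _ (by positivity))
  choose c hcC hcD using hex
  have hlim : Tendsto (fun n => dist x (c n)) atTop (𝓝 D) := by
    refine tendsto_of_tendsto_of_tendsto_of_le_of_le tendsto_const_nhds ?_
      (fun n => Metric.infDist_le_dist_of_mem (hcC n)) (fun n => (hcD n).le)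
    simpa using tendsto_const_nhds.add (tendsto_one_div_add_atTop_nhds_zero_nat (𝕜 := ℝ))
  have hcoslim : Tendsto (fun n => cos (√κ * dist x (c n))) atTop (𝓝 (cos (√κ * D))) :=
    (continuous_cos.tendsto _).comp (hlim.const_mul _)
  -- The midpoint of `c m` and `c n` lies in `C`, hence at distance at least `D` from `x`. This
  -- uniform convexity makes minimizing sequences Cauchy.
  have hmid : ∀ m n, (cos (√κ * dist x (c m)) + cos (√κ * dist x (c n))) / 2
      ≤ cos (√κ * D) * cos (√κ * dist (c m) (c n) / 2) := by
    intro m n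
    have hlt : dist (c m) (c n) < π / √κ := by
      rw [lt_div_iff₀ hk, mul_comm]; linarith [hd (c m) (c n)]
    obtain ⟨_, γ, l, hγ, rfl⟩ := hX.exists_geodesic _ _ hlt
    have hlen := hγ.length_eq
    have hkl := hd (c m) (c n)
    rw [← hlen] at hkl ⊢
    rcases hγ.nonneg.eq_or_lt with h0 | hl
    · rw [← h0]
      have hle : ∀ k, cos (√κ * dist x (c k)) ≤ cos (√κ * D) := fun k =>
        cos_le_cos_of_nonneg_of_le_pi (by positivity) (by linarith [hd x (c k)])
          (mul_le_mul_of_nonneg_left (Metric.infDist_le_dist_of_mem (hcC k)) hk.le)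
      simp only [mul_zero, zero_div, cos_zero, mul_one]
      linarith [hle m, hle n]
    have ht : l / 2 ∈ Icc 0 l := ⟨by linarith, by linarith⟩
    have h1 := hX.sin_mul_cos_dist_ge hκ hd hγ x ht
    have h2 : cos (√κ * dist x (γ (l / 2))) ≤ cos (√κ * D) :=
      cos_le_cos_of_nonneg_of_le_pi (by positivity) (by linarith [hd x (γ (l / 2))])
        (mul_le_mul_of_nonneg_left (Metric.infDist_le_dist_of_mem
          (hγ.mem_of_convex hC (hcC m) (hcC n) ht)) hk.le)
    have hklpos : 0 < √κ * l := mul_pos hk hl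
    have h3 : 0 ≤ sin (√κ * l) := sin_nonneg_of_nonneg_of_le_pi hklpos.le (by linarith)
    have h4 : 0 < sin (√κ * l / 2) := sin_pos_of_pos_of_lt_pi (by positivity) (by linarith)
    have h5 := h1.trans (mul_le_mul_of_nonneg_left h2 h3)
    have e1 : √κ * (l - l / 2) = √κ * l / 2 := by ring
    have e2 : √κ * (l / 2) = √κ * l / 2 := by ring
    have e3 : sin (√κ * l) = 2 * sin (√κ * l / 2) * cos (√κ * l / 2) := by
      rw [← sin_two_mul]; congr 1; ring
    rw [e1, e2, e3] at h5
    refine le_of_mul_le_mul_left ?_ (mul_pos two_pos h4)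
    linarith
  have hcau : CauchySeq c := by
    refine Metric.cauchySeq_iff.mpr fun e he => ?_
    -- The cap at `π` keeps `η` where the cosine is decreasing.
    set η := min (√κ * e / 2) π with hη
    have hη0 : 0 < η := lt_min (by positivity) hpi
    have hcosη : cos η < 1 := by
      rw [← cos_zero]
      exact cos_lt_cos_of_nonneg_of_le_pi le_rfl (min_le_right _ _) hη0
    have hev := hcoslim.eventually (lt_mem_nhds (mul_lt_of_lt_one_right hcosD hcosη))
    obtain ⟨N, hN⟩ := eventually_atTop.mp hev
    refine ⟨N, fun m hm n hn => ?_⟩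
    by_contra hge
    have hle : η ≤ √κ * dist (c m) (c n) / 2 := (min_le_left _ _).trans
      (by have := mul_le_mul_of_nonneg_left (not_lt.mp hge) hk.le; linarith)
    have h1 := cos_le_cos_of_nonneg_of_le_pi hη0.le (by linarith [hd (c m) (c n)]) hle
    have h2 := mul_le_mul_of_nonneg_left h1 hcosD.le
    linarith [hN m hm, hN n hn, hmid m n]
  obtain ⟨u, hu⟩ := cauchySeq_tendsto_of_complete hcau
  exact ⟨u, hcl.mem_of_tendsto hu (Eventually.of_forall hcC),
    tendsto_nhds_unique (tendsto_const_nhds.dist hu) hlim⟩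

theorem metricProj_mem_nearestPoints {C : Set X} {x : X} (h : (nearestPoints C x).Nonempty) :
    metricProj C x ∈ nearestPoints C x := by
  rw [metricProj, dif_pos h]
  exact h.some_mem

end CAT

/-! ### Convergence of the inexact cyclic projections -/

open Real in
theorem mainTheorem10 {X : Type*} [MetricSpace X] [CompleteSpace X] (κ : ℝ) (hκ : 0 < κ)
    (hX : IsCAT κ X)
    (hdiam : Metric.ediam (Set.univ : Set X) < ENNReal.ofReal (Real.pi / (2 * √κ)))
    {r : ℕ} (hr : 0 < r) (C : Fin r → Set X)
    (hclosed : ∀ i, IsClosed (C i)) (hconvex : ∀ i, GeodesicallyConvex (C i))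
    (hne : (⋂ i, C i).Nonempty) (hcompact : ∃ i, LocallyCompactSpace (C i))
    (ε : ℕ → ℝ) (x : ℕ → X)
    (hx : IsInexactCyclicSeq hr (fun i => metricProj (C i)) ε x) :
    ∃ u ∈ ⋂ i, C i, Tendsto x atTop (𝓝 u) := by
  have hk : 0 < √κ := sqrt_pos.mpr hκ
  have hpi := pi_pos
  have hd : ∀ x y : X, √κ * dist x y < π / 2 := by
    intro x y
    have h1 : edist x y < ENNReal.ofReal (π / (2 * √κ)) :=
      (Metric.edist_le_ediam_of_mem (mem_univ x) (mem_univ y)).trans_lt hdiam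
    rw [edist_dist, ENNReal.ofReal_lt_ofReal_iff (by positivity), lt_div_iff₀ (by positivity)] at h1
    linarith
  have hCne : ∀ i, (C i).Nonempty := fun i => hne.mono (iInter_subset C i)
  obtain ⟨p₀, hp₀⟩ := hne
  set idx : ℕ → Fin r := fun n => ⟨n % r, Nat.mod_lt n hr⟩ with hidx
  set y : ℕ → X := fun n => metricProj (C (idx n)) (x n) with hy
  have hyn : ∀ n, y n ∈ nearestPoints (C (idx n)) (x n) := fun n =>
    metricProj_mem_nearestPoints
      (hX.nearestPoints_nonempty hκ hd (hconvex _) (hclosed _) (hCne _) (x n))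
  have hstep : ∀ n, dist (x (n + 1)) (y n) ≤ ε n := hx.step
  have hε0 : ∀ n, 0 ≤ ε n := fun n => dist_nonneg.trans (hstep n)
  have hεlim : Tendsto ε atTop (𝓝 0) := hx.summable.tendsto_atTop_zero
  have hpyth : ∀ p ∈ ⋂ i, C i, ∀ n, cos (√κ * dist (x n) p)
      ≤ cos (√κ * dist (x n) (y n)) * cos (√κ * dist (y n) p) := fun p hp n =>
    hX.cos_dist_le_of_mem_nearestPoints hκ hd (hconvex _) (hyn n) (mem_iInter.mp hp _)
  have hcospos : ∀ u v : X, 0 < cos (√κ * dist u v) := fun u v =>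
    cos_pos_of_mem_Ioo ⟨by linarith [mul_nonneg hk.le (dist_nonneg (x := u) (y := v))], hd u v⟩
  have hquasi : ∀ p ∈ ⋂ i, C i, ∀ n, dist (y n) p ≤ dist (x n) p := by
    intro p hp n
    by_contra hlt
    have h1 := cos_lt_cos_of_nonneg_of_le_pi (by positivity) (by linarith [hd (y n) p])
      (mul_lt_mul_of_pos_left (not_le.mp hlt) hk)
    have h2 := mul_le_mul_of_nonneg_right (cos_le_one (√κ * dist (x n) (y n)))
      (hcospos (y n) p).le
    linarith [hpyth p hp n]
  have hfejer : ∀ p ∈ ⋂ i, C i, ∀ n, dist (x (n + 1)) p ≤ dist (y n) p + ε n := fun p hp n => by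
    linarith [dist_triangle (x (n + 1)) (y n) p, hstep n]
  have hconv : ∀ p ∈ ⋂ i, C i, ∃ L, Tendsto (fun n => dist (x n) p) atTop (𝓝 L) := fun p hp =>
    exists_tendsto_of_le_add_summable (fun n => dist_nonneg) hε0 hx.summable
      fun n => (hfejer p hp n).trans (by linarith [hquasi p hp n])
  have hxy : Tendsto (fun n => dist (x n) (y n)) atTop (𝓝 0) := by
    obtain ⟨L, hL⟩ := hconv p₀ hp₀
    have hyL : Tendsto (fun n => dist (y n) p₀) atTop (𝓝 L) := by
      refine tendsto_of_tendsto_of_tendsto_of_le_of_le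
        (g := fun n => dist (x (n + 1)) p₀ - ε n) ?_ hL
        (fun n => by simp only; linarith [hfejer p₀ hp₀ n]) (hquasi p₀ hp₀)
      simpa using ((tendsto_add_atTop_iff_nat 1).mpr hL).sub hεlim
    -- Pointwise strict bounds would only give `√κ * L ≤ π / 2` in the limit; strictness comes from
    -- the diameter itself.
    have hcosL : 0 < cos (√κ * L) := by
      have hbound : ∀ n, dist (x n) p₀ ≤ Metric.diam (univ : Set X) := fun n =>
        Metric.dist_le_diam_of_mem' (hdiam.trans_le le_top).ne (mem_univ _) (mem_univ _)
      have hL0 : 0 ≤ L := ge_of_tendsto' hL fun n => dist_nonneg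
      have hLd : L ≤ Metric.diam (univ : Set X) := le_of_tendsto' hL hbound
      have hdd : Metric.diam (univ : Set X) < π / (2 * √κ) :=
        (ENNReal.lt_ofReal_iff_toReal_lt (hdiam.trans_le le_top).ne).mp hdiam
      have h1 := hLd.trans_lt hdd
      rw [lt_div_iff₀ (by positivity)] at h1
      exact cos_pos_of_mem_Ioo ⟨by linarith [mul_nonneg hk.le hL0], by linarith⟩
    have hcx : Tendsto (fun n => cos (√κ * dist (x n) p₀)) atTop (𝓝 (cos (√κ * L))) :=
      (continuous_cos.tendsto _).comp (hL.const_mul _)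
    have hcy : Tendsto (fun n => cos (√κ * dist (y n) p₀)) atTop (𝓝 (cos (√κ * L))) :=
      (continuous_cos.tendsto _).comp (hyL.const_mul _)
    have hone : Tendsto (fun n => cos (√κ * dist (x n) (y n))) atTop (𝓝 1) := by
      have hq := hcx.div hcy hcosL.ne'
      rw [div_self hcosL.ne'] at hq
      exact tendsto_of_tendsto_of_tendsto_of_le_of_le hq tendsto_const_nhds
        (fun n => (div_le_iff₀ (hcospos _ _)).mpr (hpyth p₀ hp₀ n)) (fun n => cos_le_one _)
    have h0 := (tendsto_zero_of_tendsto_cos_one (fun n => by positivity)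
      (fun n => by linarith [hd (x n) (y n)]) hone).const_mul (√κ)⁻¹
    simpa [inv_mul_cancel_left₀ hk.ne'] using h0
  have hxx : Tendsto (fun n => dist (x n) (x (n + 1))) atTop (𝓝 0) := by
    refine squeeze_zero (fun n => dist_nonneg) (fun n => ?_)
      (by simpa using hxy.add hεlim)
    linarith [dist_triangle_right (x n) (x (n + 1)) (y n), hstep n]
  have hinf : ∀ i, Tendsto (fun n => Metric.infDist (x n) (C i)) atTop (𝓝 0) := by
    intro i
    have hsum : Tendsto (fun n => ∑ j ∈ Finset.range r,
        (dist (x (n + j)) (x (n + j + 1)) + dist (x (n + j)) (y (n + j)))) atTop (𝓝 0) := by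
      have := tendsto_finsetSum (Finset.range r) fun j _ =>
        (tendsto_add_atTop_iff_nat j).mpr (hxx.add hxy)
      simpa using this
    refine squeeze_zero (fun n => Metric.infDist_nonneg) (fun n => ?_) hsum
    obtain ⟨j, hj, hji⟩ : ∃ j < r, idx (n + j) = i := by
      -- The residue of `i - n` modulo `r`, written without truncated subtraction going wrong.
      refine ⟨(i + (r - n % r)) % r, Nat.mod_lt _ hr, Fin.ext ?_⟩
      have hn := Nat.mod_lt n hr
      have h1 : n + (i + (r - n % r)) = i + r * (n / r + 1) := by
        have := Nat.mod_add_div n r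
        rw [mul_add, mul_one]
        omega
      simp only [hidx, Nat.add_mod_mod]
      rw [h1, Nat.add_mul_mod_self_left, Nat.mod_eq_of_lt i.isLt]
    have h1 : Metric.infDist (x n) (C i) ≤ dist (x n) (y (n + j)) :=
      Metric.infDist_le_dist_of_mem (hji ▸ (hyn (n + j)).1)
    have h2 : dist (x n) (x (n + j))
        ≤ ∑ m ∈ Finset.range j, dist (x (n + m)) (x (n + m + 1)) := by
      exact dist_le_range_sum_dist (fun m => x (n + m)) j
    have h3 : ∑ m ∈ Finset.range j, dist (x (n + m)) (x (n + m + 1))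
        ≤ ∑ m ∈ Finset.range r, dist (x (n + m)) (x (n + m + 1)) :=
      Finset.sum_le_sum_of_subset_of_nonneg (Finset.range_mono hj.le) fun _ _ _ => dist_nonneg
    have h4 : dist (x (n + j)) (y (n + j))
        ≤ ∑ m ∈ Finset.range r, dist (x (n + m)) (y (n + m)) :=
      Finset.single_le_sum (f := fun m => dist (x (n + m)) (y (n + m)))
        (fun _ _ => dist_nonneg) (Finset.mem_range.mpr hj)
    rw [Finset.sum_add_distrib]
    linarith [dist_triangle (x n) (x (n + j)) (y (n + j))]
  obtain ⟨i₀, hloc⟩ := hcompact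
  have hcomp : CompleteSpace (C i₀) := (hclosed i₀).completeSpace_coe
  have hproper : ProperSpace (C i₀) := by
    refine properSpace_of_exists_between fun a b t ht => ?_
    have hlt : dist (a : X) b < π / √κ := by
      rw [lt_div_iff₀ hk, mul_comm]; linarith [hd a b]
    obtain ⟨_, γ, l, hγ, rfl⟩ := hX.exists_geodesic _ _ hlt
    have hlen := hγ.length_eq
    have ht' : t ∈ Icc 0 l := by rw [hlen]; exact ht
    exact ⟨⟨γ t, hγ.mem_of_convex (hconvex i₀) a.2 b.2 ht'⟩, hγ.dist_left ht',
      (hγ.dist_right ht').trans (by rw [hlen]; rfl)⟩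
  -- Almost nearest points suffice: only `dist (x n) (q n) → 0` is needed.
  have hex : ∀ n : ℕ, ∃ q : C i₀,
      dist (x n) q < Metric.infDist (x n) (C i₀) + 1 / ((n : ℝ) + 1) := fun n => by
    obtain ⟨q, hq, hlt⟩ := (Metric.infDist_lt_iff (hCne i₀)).mp
      (lt_add_of_pos_right (Metric.infDist (x n) (C i₀)) (by positivity : 0 < 1 / ((n : ℝ) + 1)))
    exact ⟨⟨q, hq⟩, hlt⟩
  choose q hq using hex
  have hqx : Tendsto (fun n => dist (x n) (q n)) atTop (𝓝 0) :=
    squeeze_zero (fun n => dist_nonneg) (fun n => (hq n).le)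
      (by simpa using (hinf i₀).add (tendsto_one_div_add_atTop_nhds_zero_nat (𝕜 := ℝ)))
  have hqball : ∀ n, q n ∈ Metric.closedBall (q 0) (π / 2 / √κ) := fun n => by
    rw [Metric.mem_closedBall, le_div_iff₀ hk, mul_comm]
    exact (hd (q n) (q 0)).le
  obtain ⟨u, -, φ, hφ, hqu⟩ := (isCompact_closedBall (q 0) (π / 2 / √κ)).tendsto_subseq hqball
  have hqu' : Tendsto (fun n => ((q (φ n) : C i₀) : X)) atTop (𝓝 (u : X)) :=
    (continuous_subtype_val.tendsto u).comp hqu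
  have hxu : Tendsto (fun n => x (φ n)) atTop (𝓝 (u : X)) := by
    rw [tendsto_iff_dist_tendsto_zero] at hqu' ⊢
    exact squeeze_zero (fun n => dist_nonneg)
      (fun n => dist_triangle (x (φ n)) (q (φ n)) u)
      (by simpa using (hqx.comp hφ.tendsto_atTop).add hqu')
  have huC : (u : X) ∈ ⋂ i, C i := by
    refine mem_iInter.mpr fun i => ?_
    rw [(hclosed i).mem_iff_infDist_zero (hCne i)]
    exact tendsto_nhds_unique (((Metric.continuous_infDist_pt (C i)).tendsto _).comp hxu)
      ((hinf i).comp hφ.tendsto_atTop)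
  refine ⟨u, huC, ?_⟩
  obtain ⟨L, hL⟩ := hconv u huC
  have hL0 : L = 0 := tendsto_nhds_unique (hL.comp hφ.tendsto_atTop)
    (tendsto_iff_dist_tendsto_zero.mp hxu)
  rw [tendsto_iff_dist_tendsto_zero]
  exact hL0 ▸ hL
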